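/- Let $H$ be a separable real Hilbert space, $X$ a random variable with values in $H$, and $m$ a geometric median of $X$, that is, a minimizer over $h\in H$ of $G(h)=\mathbb{E}\left[\|X-h\|-\|X\|\right]$. Assume: (A1) for every $h\in H$ there is $h'\in H$ with $\langle h,h'\rangle=0$ and $\operatorname{Var}(\langle h',X\rangle)>0$ (the variance being $+\infty$ when $\langle h',X\rangle$ has no second moment); (A2) there is $C>0$ with $\mathbb{E}\left[\|X-h\|^{-1}\right]\le C$ for all $h\in H$; (A3) there is $C>0$ with $\mathbb{E}\left[\|X-h\|^{-2}\right]\le C$ for all $h\in H$. (In (A2) and (A3), $0^{-1}=+\infty$.) Let $X_1,X_2,\dots$ be i.i.d. copies of $X$, and let $Z_1$ be an a.s. bounded $H$-valued random variable that is independent of $(X_n)_{n\ge 2}$ (for example a bounded measurable function of $X_1$). Let $c_\gamma>0$, $\alpha\in(1/2,1)$, $\gamma_n=c_\gamma n^{-\alpha}$, and define $$Z_{n+1}=Z_n+\gamma_n\frac{X_{n+1}-Z_n}{\|X_{n+1}-Z_n\|},\qquad n\ge 1.$$ Then, if $Z_1$ is not almost surely equal to $m$, there is a constant $C'>0$ such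 that $$\mathbb{E}\left[\|Z_n-m\|^2\right]\ge \frac{C'}{n^{\alpha}}\qquad\text{for all } n\ge 1.$$ Without this proviso on $Z_1$, there is a constant $C'>0$ such that the same inequality holds for all $n\ge 2$. In particular $\mathbb{E}\left[\|Z_n-m\|^2\right]$ is not $O(1/n)$: the non-averaged Robbins–Monro iterate does not reach the parametric rate. -/

import Mathlib

open MeasureTheory ProbabilityTheory Filter Asymptotics
open scoped ENNReal NNReal

noncomputable section

namespace OnlineMedian

variable {Ω : Type*} [MeasurableSpace Ω]
variable {H : Type*} [NormedAddCommGroup H] [InnerProductSpace ℝ H]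

/-- The objective function `G(h) = 𝔼[‖X - h‖ - ‖X‖]`. For a random variable `X` the integrand is
bounded in absolute value by `‖h‖`, so that no moment of `X` is needed. -/
def medianObjective (P : Measure Ω) (X : Ω → H) (h : H) : ℝ :=
  ∫ ω, (‖X ω - h‖ - ‖X ω‖) ∂P

/-- `m` is a geometric median of `X`: a minimizer of `G` over the whole space. -/
def IsGeometricMedian (P : Measure Ω) (X : Ω → H) (m : H) : Prop :=
  ∀ h : H, medianObjective P X m ≤ medianObjective P X h

/-- `X` is not concentrated on a straight line: for every `h` there is `h' ⟂ h` with
`Var ⟨h', X⟩ > 0`. The variance is taken in `[0, ∞]`, so that a variable without a second moment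
counts as having positive variance. -/
def NotOnLine (P : Measure Ω) (X : Ω → H) : Prop :=
  ∀ h : H, ∃ h' : H, inner ℝ h h' = 0 ∧ 0 < evariance (fun ω => inner ℝ h' (X ω)) P

/-- `sup_h 𝔼[‖X - h‖⁻¹] < ∞`. The expectation is taken in `[0, ∞]`, where `0⁻¹ = ∞`. -/
def BoundedInvMoment (P : Measure Ω) (X : Ω → H) : Prop :=
  ∃ C : ℝ≥0, 0 < C ∧ ∀ h : H, ∫⁻ ω, ‖X ω - h‖ₑ⁻¹ ∂P ≤ C

/-- `sup_h 𝔼[‖X - h‖⁻²] < ∞`. The expectation is taken in `[0, ∞]`, where `0⁻¹ = ∞`. -/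
def BoundedInvSqMoment (P : Measure Ω) (X : Ω → H) : Prop :=
  ∃ C : ℝ≥0, 0 < C ∧ ∀ h : H, ∫⁻ ω, (‖X ω - h‖ₑ ^ 2)⁻¹ ∂P ≤ C

/-- `Xs 1, Xs 2, …` are independent copies of `X` (the value `Xs 0` plays no role). -/
structure IsIIDCopies [MeasurableSpace H] (P : Measure Ω) (X : Ω → H) (Xs : ℕ → Ω → H) :
    Prop where
  indep : iIndepFun (fun n : ℕ => Xs (n + 1)) P
  identDistrib : ∀ n : ℕ, 1 ≤ n → IdentDistrib (Xs n) X P P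

/-- The Robbins–Monro iterates started at `Z₁`:
`Z (n + 1) = Z n + γ n • (X (n + 1) - Z n) / ‖X (n + 1) - Z n‖` for `n ≥ 1`.
Indices start at `1`; the value at index `0` is a placeholder. -/
def robbinsMonro (γ : ℕ → ℝ) (Xs : ℕ → Ω → H) (Z₁ : Ω → H) : ℕ → Ω → H
  | 0 => Z₁
  | 1 => Z₁
  | n + 2 => fun ω =>
      robbinsMonro γ Xs Z₁ (n + 1) ω +
        γ (n + 1) • (‖Xs (n + 2) ω - robbinsMonro γ Xs Z₁ (n + 1) ω‖⁻¹ •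
          (Xs (n + 2) ω - robbinsMonro γ Xs Z₁ (n + 1) ω))

/-- The step sizes `γ n = c n ^ (-α)`. -/
def stepSize (c α : ℝ) (n : ℕ) : ℝ := c * (n : ℝ) ^ (-α)

/-- The quadratic error `𝔼[‖Z n - m‖²]`. -/
def quadError (P : Measure Ω) (Z : ℕ → Ω → H) (m : H) (n : ℕ) : ℝ :=
  ∫ ω, ‖Z n ω - m‖ ^ 2 ∂P

end OnlineMedian

end

/-! Write `V n` for the quadratic error and `u` for the unit direction. Expanding the square over
one step gives `V (n+1) = V n + 2 γ 𝔼⟪u(X - Z), Z - m⟫ + γ²`, since almost surely the step has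
length exactly `γ`. The mean direction `h ↦ 𝔼 u(X - h)` vanishes at the median and is `2C`-Lipschitz
by (A2), so the middle term is at least `-4Cγ V n` (`le_quadError_succ`). The noise `γ²` added at
each step thus balances a contraction no stronger than `1 - 4Cγ`, and this keeps `V n` above a
multiple of `γ n` (`exists_const_mul_le_of_recursion`). The induction covers large `n`; the finitely
many earlier terms only need `V n > 0`, which (A1) supplies from `n = 2` on (`quadError_succ_pos`).
-/

namespace OnlineMedian
open scoped RealInnerProductSpace

/-! ### Geometry of the unit direction -/

section UnitDirection

variable {H : Type*} [NormedAddCommGroup H] [InnerProductSpace ℝ H]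

/-- The unit vector in the direction of `x`, with value `0` at `0`. -/
noncomputable def unitDir (x : H) : H := ‖x‖⁻¹ • x

lemma norm_unitDir {x : H} (hx : x ≠ 0) : ‖unitDir x‖ = 1 := by
  rw [unitDir, norm_smul, norm_inv, norm_norm, inv_mul_cancel₀ (norm_ne_zero_iff.2 hx)]

lemma norm_unitDir_le_one (x : H) : ‖unitDir x‖ ≤ 1 := by
  rcases eq_or_ne x 0 with rfl | hx
  · simp [unitDir]
  · exact (norm_unitDir hx).le

/-- The bound involves `‖x‖⁻¹` alone, so after integration one inverse moment suffices. -/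
lemma norm_unitDir_sub_le {x : H} (hx : x ≠ 0) (y : H) :
    ‖unitDir x - unitDir y‖ ≤ 2 * ‖x - y‖ * ‖x‖⁻¹ := by
  have hx' : 0 < ‖x‖ := norm_pos_iff.2 hx
  rcases eq_or_ne y 0 with rfl | hy
  · have h1 := norm_unitDir hx
    have h2 : ‖x‖ * ‖x‖⁻¹ = 1 := mul_inv_cancel₀ hx'.ne'
    simp only [unitDir, smul_zero, sub_zero] at h1 ⊢
    rw [h1, mul_assoc, h2]
    norm_num
  · have hy' : 0 < ‖y‖ := norm_pos_iff.2 hy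
    -- The bracket is `x - ‖x‖ • unitDir y`; both of its summands have norm at most `‖x - y‖`.
    have e : unitDir x - unitDir y = ‖x‖⁻¹ • ((x - y) + (‖y‖ - ‖x‖) • unitDir y) := by
      have : ‖x‖⁻¹ * ((‖y‖ - ‖x‖) * ‖y‖⁻¹) = ‖x‖⁻¹ - ‖y‖⁻¹ := by field_simp
      simp only [unitDir, smul_add, smul_smul, smul_sub, this, sub_smul]
      abel
    rw [e, norm_smul, norm_inv, norm_norm, mul_comm]
    gcongr
    calc ‖(x - y) + (‖y‖ - ‖x‖) • unitDir y‖
        ≤ ‖x - y‖ + ‖(‖y‖ - ‖x‖) • unitDir y‖ := norm_add_le _ _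
      _ = ‖x - y‖ + |‖y‖ - ‖x‖| := by
          rw [norm_smul, norm_unitDir hy, mul_one, Real.norm_eq_abs]
      _ ≤ 2 * ‖x - y‖ := by
          rw [abs_sub_comm]
          linarith [abs_norm_sub_norm_le x y]

/-- Convexity of the norm: `unitDir x` is a subgradient at `x`, also at `x = 0`. -/
lemma norm_sub_norm_le_inner_unitDir (x y : H) : ‖x‖ - ‖y‖ ≤ ⟪unitDir x, x - y⟫ := by
  have h1 : ⟪unitDir x, x⟫ = ‖x‖ := by
    rcases eq_or_ne x 0 with rfl | hx
    · simp
    · have := norm_ne_zero_iff.2 hx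
      rw [unitDir, real_inner_smul_left, real_inner_self_eq_norm_sq]
      field_simp
  have h2 : ⟪unitDir x, y⟫ ≤ ‖y‖ :=
    (real_inner_le_norm _ _).trans
      (mul_le_of_le_one_left (norm_nonneg _) (norm_unitDir_le_one x))
  rw [inner_sub_right, h1]
  linarith

lemma abs_inner_unitDir_le (x y : H) : |⟪unitDir x, y⟫| ≤ ‖y‖ :=
  (abs_real_inner_le_norm _ _).trans
    (mul_le_of_le_one_left (norm_nonneg _) (norm_unitDir_le_one x))

variable [MeasurableSpace H] [BorelSpace H] [SecondCountableTopology H]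

lemma measurable_unitDir : Measurable (unitDir : H → H) :=
  measurable_norm.inv.smul measurable_id

end UnitDirection

/-! ### The mean direction and the first-order condition at the median -/

section Gradient

variable {Ω : Type*} [MeasurableSpace Ω] {P : Measure Ω}
variable {H : Type*} [NormedAddCommGroup H] [MeasurableSpace H] [BorelSpace H]
  {X : Ω → H} {m : H} {C : ℝ≥0}

lemma ae_ne_of_lintegral_inv_le (hX : Measurable X)
    (hC : ∀ h : H, ∫⁻ ω, ‖X ω - h‖ₑ⁻¹ ∂P ≤ C) (h : H) : ∀ᵐ ω ∂P, X ω ≠ h := by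
  have hm : Measurable fun ω => ‖X ω - h‖ₑ⁻¹ := (hX.sub_const h).enorm.inv
  filter_upwards [ae_lt_top hm ((hC h).trans_lt ENNReal.coe_lt_top).ne] with ω hω he
  simp [he] at hω

lemma integrable_inv_norm_sub (hX : Measurable X)
    (hC : ∀ h : H, ∫⁻ ω, ‖X ω - h‖ₑ⁻¹ ∂P ≤ C) (h : H) :
    Integrable (fun ω => ‖X ω - h‖⁻¹) P ∧ ∫ ω, ‖X ω - h‖⁻¹ ∂P ≤ C := by
  have hm : Measurable fun ω => ‖X ω - h‖⁻¹ := (hX.sub_const h).norm.inv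
  have e : ∫⁻ ω, ‖‖X ω - h‖⁻¹‖ₑ ∂P ≤ C := by
    refine le_trans (le_of_eq (lintegral_congr_ae ?_)) (hC h)
    filter_upwards [ae_ne_of_lintegral_inv_le hX hC h] with ω hω
    rw [enorm_inv (norm_ne_zero_iff.2 (sub_ne_zero.2 hω)), enorm_norm]
  refine ⟨⟨hm.aestronglyMeasurable, e.trans_lt ENNReal.coe_lt_top⟩, ?_⟩
  have h1 : ∫ ω, ‖X ω - h‖⁻¹ ∂P = ∫ ω, ‖‖X ω - h‖⁻¹‖ ∂P := by simp
  rw [h1, integral_norm_eq_lintegral_enorm hm.aestronglyMeasurable]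
  exact ENNReal.toReal_le_coe_of_le_coe e

variable [InnerProductSpace ℝ H] [SecondCountableTopology H] [IsProbabilityMeasure P]

lemma integrable_inner_unitDir (hX : Measurable X) (h v : H) :
    Integrable (fun ω => ⟪unitDir (X ω - h), v⟫) P := by
  refine Integrable.of_bound (C := ‖v‖) ?_ (ae_of_all _ fun ω => abs_inner_unitDir_le _ _)
  exact ((measurable_unitDir.comp (hX.sub_const h)).inner_const).aestronglyMeasurable

lemma integral_inner_unitDir_sub_le (hX : Measurable X)
    (hC : ∀ h : H, ∫⁻ ω, ‖X ω - h‖ₑ⁻¹ ∂P ≤ C) (h k v : H) :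
    ∫ ω, ⟪unitDir (X ω - h), v⟫ ∂P - ∫ ω, ⟪unitDir (X ω - k), v⟫ ∂P
      ≤ 2 * C * ‖h - k‖ * ‖v‖ := by
  obtain ⟨hi, hle⟩ := integrable_inv_norm_sub hX hC h
  rw [← integral_sub (integrable_inner_unitDir hX h v) (integrable_inner_unitDir hX k v)]
  calc ∫ ω, (⟪unitDir (X ω - h), v⟫ - ⟪unitDir (X ω - k), v⟫) ∂P
      ≤ ∫ ω, 2 * ‖h - k‖ * ‖v‖ * ‖X ω - h‖⁻¹ ∂P := by
        refine integral_mono_ae ((integrable_inner_unitDir hX h v).sub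
          (integrable_inner_unitDir hX k v)) (hi.const_mul _) ?_
        filter_upwards [ae_ne_of_lintegral_inv_le hX hC h] with ω hω
        have h1 := norm_unitDir_sub_le (sub_ne_zero.2 hω) (X ω - k)
        rw [sub_sub_sub_cancel_left, norm_sub_rev k h] at h1
        rw [← inner_sub_left]
        calc _ ≤ ‖unitDir (X ω - h) - unitDir (X ω - k)‖ * ‖v‖ := real_inner_le_norm _ _
          _ ≤ (2 * ‖h - k‖ * ‖X ω - h‖⁻¹) * ‖v‖ := by gcongr
          _ = _ := by ring
    _ = 2 * ‖h - k‖ * ‖v‖ * ∫ ω, ‖X ω - h‖⁻¹ ∂P := integral_const_mul _ _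
    _ ≤ 2 * ‖h - k‖ * ‖v‖ * C := by gcongr
    _ = _ := by ring

/-- `G` is never differentiated: the subgradient inequality at `m + t • v` and minimality give the
sign there, and the Lipschitz bound carries it to `m` as `t` tends to `0`. -/
lemma IsGeometricMedian.integral_inner_unitDir_nonpos (hX : Measurable X)
    (hC : ∀ h : H, ∫⁻ ω, ‖X ω - h‖ₑ⁻¹ ∂P ≤ C) (hm : IsGeometricMedian P X m) (v : H) :
    ∫ ω, ⟪unitDir (X ω - m), v⟫ ∂P ≤ 0 := by
  have hint : ∀ h : H, Integrable (fun ω => ‖X ω - h‖ - ‖X ω‖) P := fun h => by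
    refine Integrable.of_bound (C := ‖h‖)
      ((hX.sub_const h).norm.sub hX.norm).aestronglyMeasurable (ae_of_all _ fun ω => ?_)
    simpa using abs_norm_sub_norm_le (X ω - h) (X ω)
  have key : ∀ t : ℝ, 0 < t → ∫ ω, ⟪unitDir (X ω - (m + t • v)), v⟫ ∂P ≤ 0 := fun t ht => by
    have h1 : medianObjective P X (m + t • v) - medianObjective P X m
        ≤ ∫ ω, -t * ⟪unitDir (X ω - (m + t • v)), v⟫ ∂P := by
      rw [medianObjective, medianObjective, ← integral_sub (hint _) (hint _)]
      refine integral_mono ((hint _).sub (hint _))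
        ((integrable_inner_unitDir hX _ _).const_mul _) fun ω => ?_
      have h2 := norm_sub_norm_le_inner_unitDir (X ω - (m + t • v)) (X ω - m)
      have h3 : X ω - (m + t • v) - (X ω - m) = (-t) • v := by rw [neg_smul]; abel
      rw [h3, real_inner_smul_right] at h2
      simpa using h2
    rw [integral_const_mul] at h1
    have h4 := hm (m + t • v)
    nlinarith
  refine le_of_forall_pos_le_add fun ε hε => ?_
  set K : ℝ := 2 * C * ‖v‖ * ‖v‖ with hK
  have hK0 : 0 ≤ K := by positivity
  -- With `t = ε / (K + 1)` the Lipschitz error `t * K` is at most `ε`, even if `K = 0`.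
  have ht : 0 < ε / (K + 1) := by positivity
  have h1 := integral_inner_unitDir_sub_le hX hC m (m + (ε / (K + 1)) • v) v
  rw [sub_add_cancel_left, norm_neg, norm_smul, Real.norm_of_nonneg ht.le] at h1
  have h2 : 2 * C * (ε / (K + 1) * ‖v‖) * ‖v‖ = ε * (K / (K + 1)) := by rw [hK]; ring
  have h3 : K / (K + 1) ≤ 1 := (div_le_one (by positivity)).2 (by linarith)
  have h4 := key _ ht
  nlinarith

lemma IsGeometricMedian.neg_le_integral_inner_unitDir (hX : Measurable X)
    (hC : ∀ h : H, ∫⁻ ω, ‖X ω - h‖ₑ⁻¹ ∂P ≤ C) (hm : IsGeometricMedian P X m) (h : H) :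
    -(2 * C * ‖h - m‖ ^ 2) ≤ ∫ ω, ⟪unitDir (X ω - h), h - m⟫ ∂P := by
  have h1 := hm.integral_inner_unitDir_nonpos hX hC (m - h)
  have h2 := integral_inner_unitDir_sub_le hX hC h m (m - h)
  have e : ∫ ω, ⟪unitDir (X ω - h), m - h⟫ ∂P = -∫ ω, ⟪unitDir (X ω - h), h - m⟫ ∂P := by
    rw [← integral_neg]
    refine integral_congr_ae (ae_of_all _ fun ω => ?_)
    simp only [← inner_neg_right, neg_sub]
  rw [e, norm_sub_rev m h] at h2
  nlinarith

end Gradient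
-- Independence of the iterate and the next observation
section Iterates

variable {Ω : Type*} [MeasurableSpace Ω] {P : Measure Ω}

/-- Associativity of product measures. It serves with `A = Z₁`, `B` the past observations and `D`
the next one. -/
lemma _root_.ProbabilityTheory.IndepFun.prodMk_left_of_prodMk_right [IsProbabilityMeasure P]
    {α β δ : Type*} [MeasurableSpace α] [MeasurableSpace β] [MeasurableSpace δ]
    {A : Ω → α} {B : Ω → β} {D : Ω → δ} (hA : Measurable A) (hB : Measurable B)
    (hD : Measurable D) (h : IndepFun A (fun ω => (B ω, D ω)) P) (h' : IndepFun B D P) :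
    IndepFun (fun ω => (A ω, B ω)) D P := by
  have := Measure.isProbabilityMeasure_map (μ := P) hA.aemeasurable
  have := Measure.isProbabilityMeasure_map (μ := P) hB.aemeasurable
  have := Measure.isProbabilityMeasure_map (μ := P) hD.aemeasurable
  have hAB : IndepFun A B P := h.comp measurable_id measurable_fst
  rw [indepFun_iff_map_prod_eq_prod_map_map (by fun_prop) (by fun_prop)] at h h' hAB ⊢
  rw [hAB]
  have e : (fun ω => ((A ω, B ω), D ω))
      = MeasurableEquiv.prodAssoc.symm ∘ fun ω => (A ω, (B ω, D ω)) := rfl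
  rw [e, ← Measure.map_map (by fun_prop) (by fun_prop), h, h',
    ← Measure.prodAssoc_prod, Measure.map_map (by fun_prop) (by fun_prop)]
  simp

variable {H : Type*} [NormedAddCommGroup H] [InnerProductSpace ℝ H]

lemma robbinsMonro_succ {Ω : Type*} (γ : ℕ → ℝ) (Xs : ℕ → Ω → H) (Z₁ : Ω → H) {n : ℕ} (hn : 1 ≤ n)
    (ω : Ω) :
    robbinsMonro γ Xs Z₁ (n + 1) ω = robbinsMonro γ Xs Z₁ n ω
      + γ n • unitDir (Xs (n + 1) ω - robbinsMonro γ Xs Z₁ n ω) := by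
  obtain ⟨k, rfl⟩ := Nat.exists_eq_add_of_le' hn
  rfl

lemma exists_ae_norm_robbinsMonro_le (γ : ℕ → ℝ) (Xs : ℕ → Ω → H) {Z₁ : Ω → H}
    (hZ₁ : ∃ R : ℝ, ∀ᵐ ω ∂P, ‖Z₁ ω‖ ≤ R) {n : ℕ} (hn : 1 ≤ n) :
    ∃ R : ℝ, ∀ᵐ ω ∂P, ‖robbinsMonro γ Xs Z₁ n ω‖ ≤ R := by
  induction n, hn using Nat.le_induction with
  | base => exact hZ₁
  | succ n hn ih =>
    obtain ⟨R, hR⟩ := ih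
    refine ⟨R + |γ n|, ?_⟩
    filter_upwards [hR] with ω hω
    rw [robbinsMonro_succ γ Xs Z₁ hn]
    refine (norm_add_le _ _).trans (add_le_add hω ?_)
    rw [norm_smul, Real.norm_eq_abs]
    exact mul_le_of_le_one_right (abs_nonneg _) (norm_unitDir_le_one _)

/-- The iterate `Z n` as a function of `Z 1` and the observations `X 2, …, X n`. -/
lemma exists_robbinsMonro_eq_comp {Ω : Type*} [MeasurableSpace H] [BorelSpace H] [SecondCountableTopology H]
    (γ : ℕ → ℝ) (Xs : ℕ → Ω → H) (Z₁ : Ω → H) (n : ℕ) :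
    ∃ φ : H × (Finset.Ico 1 (n + 1) → H) → H, Measurable φ ∧
      ∀ ω, robbinsMonro γ Xs Z₁ (n + 1) ω
        = φ (Z₁ ω, fun i : Finset.Ico 1 (n + 1) => Xs (i + 1) ω) := by
  induction n with
  | zero => exact ⟨Prod.fst, measurable_fst, fun ω => rfl⟩
  | succ n ih =>
    obtain ⟨φ, hφ, h⟩ := ih
    have hs : ∀ i ∈ Finset.Ico 1 (n + 1), i ∈ Finset.Ico 1 (n + 1 + 1) := fun i hi => by
      simp only [Finset.mem_Ico] at hi ⊢
      omega
    have hl : n + 1 ∈ Finset.Ico 1 (n + 1 + 1) := by simp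
    let r : H × (Finset.Ico 1 (n + 1 + 1) → H) → H :=
      fun p => φ (p.1, fun i => p.2 ⟨i, hs i i.2⟩)
    have hr : Measurable r := hφ.comp (by fun_prop)
    refine ⟨fun p => r p + γ (n + 1) • unitDir (p.2 ⟨n + 1, hl⟩ - r p),
      hr.add ((measurable_unitDir.comp (Measurable.sub (by fun_prop) hr)).const_smul _),
      fun ω => ?_⟩
    rw [robbinsMonro_succ γ Xs Z₁ (Nat.le_add_left 1 n), h]

variable [MeasurableSpace H] [BorelSpace H] [SecondCountableTopology H]
  {X : Ω → H} {Xs : ℕ → Ω → H} {Z₁ : Ω → H}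

lemma measurable_robbinsMonro (γ : ℕ → ℝ) (hXs : ∀ n, 1 ≤ n → Measurable (Xs n))
    (hZ₁ : Measurable Z₁) {n : ℕ} (hn : 1 ≤ n) : Measurable (robbinsMonro γ Xs Z₁ n) := by
  induction n, hn using Nat.le_induction with
  | base => exact hZ₁
  | succ n hn ih =>
    rw [funext fun ω => robbinsMonro_succ γ Xs Z₁ hn ω]
    exact ih.add ((measurable_unitDir.comp ((hXs _ (by omega)).sub ih)).const_smul _)

variable [IsProbabilityMeasure P]

lemma indepFun_robbinsMonro (γ : ℕ → ℝ) (hXs_meas : ∀ n, 1 ≤ n → Measurable (Xs n))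
    (hXs : IsIIDCopies P X Xs) (hZ₁_meas : Measurable Z₁)
    (hZ₁_indep : IndepFun Z₁ (fun ω (n : ℕ) => Xs (n + 2) ω) P) {n : ℕ} (hn : 1 ≤ n) :
    IndepFun (robbinsMonro γ Xs Z₁ n) (Xs (n + 1)) P := by
  obtain ⟨n, rfl⟩ := Nat.exists_eq_add_of_le' hn
  obtain ⟨φ, hφ, h⟩ := exists_robbinsMonro_eq_comp γ Xs Z₁ n
  have hX' : ∀ i, Measurable (Xs (i + 1)) := fun i => hXs_meas _ (by omega)
  let B : Ω → (Finset.Ico 1 (n + 1) → H) := fun ω i => Xs (i + 1) ω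
  have hB : Measurable B := measurable_pi_lambda _ fun i => hX' i
  have h1 : IndepFun B (Xs (n + 1 + 1)) P :=
    (hXs.indep.indepFun_finset (Finset.Ico 1 (n + 1)) {n + 1} (by simp) hX').comp measurable_id
      (measurable_pi_apply (⟨n + 1, by simp⟩ : ({n + 1} : Finset ℕ)))
  have h2 : IndepFun Z₁ (fun ω => (B ω, Xs (n + 1 + 1) ω)) P := by
    -- Entry `k` of the sequence is `Xs (k + 2)`, so `Xs (i + 1)` sits at `i - 1`; no truncation
    -- occurs as `i ≥ 1`.
    let ψ : (ℕ → H) → (Finset.Ico 1 (n + 1) → H) × H := fun f => (fun i => f (i - 1), f n)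
    have hψ : Measurable ψ := by fun_prop
    have e : (fun ω => (B ω, Xs (n + 1 + 1) ω)) = ψ ∘ fun ω (k : ℕ) => Xs (k + 2) ω := by
      refine funext fun ω => Prod.ext (funext fun i => ?_) rfl
      have := (Finset.mem_Ico.1 i.2).1
      simp only [B, ψ, Function.comp_apply, show (i : ℕ) - 1 + 2 = i + 1 by omega]
    rw [e]
    exact hZ₁_indep.comp measurable_id hψ
  have h3 := h2.prodMk_left_of_prodMk_right hZ₁_meas hB (hX' _) h1
  rw [funext h]
  exact h3.comp hφ measurable_id

lemma map_robbinsMonro_prodMk (γ : ℕ → ℝ) (hXs_meas : ∀ n, 1 ≤ n → Measurable (Xs n))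
    (hXs : IsIIDCopies P X Xs) (hZ₁_meas : Measurable Z₁)
    (hZ₁_indep : IndepFun Z₁ (fun ω (n : ℕ) => Xs (n + 2) ω) P) {n : ℕ} (hn : 1 ≤ n) :
    P.map (fun ω => (robbinsMonro γ Xs Z₁ n ω, Xs (n + 1) ω))
      = (P.map (robbinsMonro γ Xs Z₁ n)).prod (P.map X) := by
  rw [(indepFun_robbinsMonro γ hXs_meas hXs hZ₁_meas hZ₁_indep hn).map_prod_eq_prod_map_map
    (measurable_robbinsMonro γ hXs_meas hZ₁_meas hn).aemeasurable
    (hXs_meas _ (by omega)).aemeasurable, (hXs.identDistrib _ (by omega)).map_eq]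

end Iterates
-- Positivity of the error and its one-step recursion
section LowerBound

variable {Ω : Type*} [MeasurableSpace Ω] {P : Measure Ω} [IsProbabilityMeasure P]
variable {H : Type*} [NormedAddCommGroup H] [InnerProductSpace ℝ H]
  [MeasurableSpace H] [BorelSpace H] [SecondCountableTopology H]
  {X : Ω → H} {m : H} {Xs : ℕ → Ω → H} {Z₁ : Ω → H}

lemma integrable_sq_norm_robbinsMonro_sub (γ : ℕ → ℝ) (m : H)
    (hXs_meas : ∀ n, 1 ≤ n → Measurable (Xs n)) (hZ₁_meas : Measurable Z₁)
    (hZ₁_bdd : ∃ R : ℝ, ∀ᵐ ω ∂P, ‖Z₁ ω‖ ≤ R) {n : ℕ} (hn : 1 ≤ n) :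
    Integrable (fun ω => ‖robbinsMonro γ Xs Z₁ n ω - m‖ ^ 2) P := by
  obtain ⟨R, hR⟩ := exists_ae_norm_robbinsMonro_le γ Xs hZ₁_bdd hn
  have hZ := measurable_robbinsMonro γ hXs_meas hZ₁_meas hn
  refine Integrable.of_bound (C := (R + ‖m‖) ^ 2)
    ((hZ.sub_const m).norm.pow_const 2).aestronglyMeasurable ?_
  filter_upwards [hR] with ω hω
  rw [Real.norm_of_nonneg (by positivity)]
  gcongr
  exact (norm_sub_le _ _).trans (by gcongr)

lemma quadError_pos_of_not_ae_eq (γ : ℕ → ℝ) (hXs_meas : ∀ n, 1 ≤ n → Measurable (Xs n))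
    (hZ₁_meas : Measurable Z₁) (hZ₁_bdd : ∃ R : ℝ, ∀ᵐ ω ∂P, ‖Z₁ ω‖ ≤ R) {n : ℕ} (hn : 1 ≤ n)
    (h : ¬ ∀ᵐ ω ∂P, robbinsMonro γ Xs Z₁ n ω = m) :
    0 < quadError P (robbinsMonro γ Xs Z₁) m n := by
  have h0 : ∀ ω, 0 ≤ ‖robbinsMonro γ Xs Z₁ n ω - m‖ ^ 2 := fun ω => by positivity
  refine lt_of_le_of_ne (integral_nonneg h0) fun h1 => h ?_
  have h2 := (integral_eq_zero_iff_of_nonneg h0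
    (integrable_sq_norm_robbinsMonro_sub γ m hXs_meas hZ₁_meas hZ₁_bdd hn)).1 h1.symm
  filter_upwards [h2] with ω hω
  simpa [sub_eq_zero] using hω

/-- A step from `z` that lands on `m` forces `X - z` to be parallel to `m - z`, or zero. Every `h'`
orthogonal to `m - z` then makes `⟪h', X⟫` constant, against (A1). -/
lemma NotOnLine.not_ae_add_unitDir_eq (hX : Measurable X) (hA1 : NotOnLine P X)
    {g : ℝ} (hg : g ≠ 0) (z m : H) :
    ¬ ∀ᵐ ω ∂P, z + g • unitDir (X ω - z) = m := fun h => by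
  obtain ⟨h', h1, h2⟩ := hA1 (m - z)
  refine h2.ne' ?_
  have hmeas : Measurable fun ω => ⟪h', X ω⟫ := hX.const_inner
  have hc : (fun ω => ⟪h', X ω⟫) =ᵐ[P] fun _ => ⟪h', z⟫ := by
    filter_upwards [h] with ω hω
    rw [← sub_eq_zero, ← inner_sub_right]
    rcases eq_or_ne (X ω) z with e | e
    · simp [e]
    · have e' : ‖X ω - z‖ ≠ 0 := norm_ne_zero_iff.2 (sub_ne_zero.2 e)
      have : m - z = (g * ‖X ω - z‖⁻¹) • (X ω - z) := by
        rw [← hω, unitDir, smul_smul, add_sub_cancel_left]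
      rw [this, real_inner_smul_left, real_inner_comm] at h1
      exact (mul_eq_zero.1 h1).resolve_left (mul_ne_zero hg (inv_ne_zero e'))
  rw [evariance_congr hc]
  simp [evariance]

lemma quadError_succ_pos {γ : ℕ → ℝ} (hX : Measurable X) (hA1 : NotOnLine P X)
    (hXs_meas : ∀ n, 1 ≤ n → Measurable (Xs n)) (hXs : IsIIDCopies P X Xs)
    (hZ₁_meas : Measurable Z₁) (hZ₁_bdd : ∃ R : ℝ, ∀ᵐ ω ∂P, ‖Z₁ ω‖ ≤ R)
    (hZ₁_indep : IndepFun Z₁ (fun ω (n : ℕ) => Xs (n + 2) ω) P) {n : ℕ} (hn : 1 ≤ n)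
    (hγ : γ n ≠ 0) (m : H) :
    0 < quadError P (robbinsMonro γ Xs Z₁) m (n + 1) := by
  refine quadError_pos_of_not_ae_eq γ hXs_meas hZ₁_meas hZ₁_bdd (by omega) fun h => ?_
  have hZ := measurable_robbinsMonro γ hXs_meas hZ₁_meas hn
  have hX1 := hXs_meas (n + 1) (by omega)
  have := Measure.isProbabilityMeasure_map (μ := P) hZ.aemeasurable
  have hF : Measurable fun p : H × H => p.1 + γ n • unitDir (p.2 - p.1) :=
    measurable_fst.add ((measurable_unitDir.comp
      (measurable_snd.sub measurable_fst)).const_smul _)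
  have h1 : ∀ᵐ p ∂(P.map (robbinsMonro γ Xs Z₁ n)).prod (P.map X),
      p.1 + γ n • unitDir (p.2 - p.1) = m := by
    rw [← map_robbinsMonro_prodMk γ hXs_meas hXs hZ₁_meas hZ₁_indep hn,
      ae_map_iff (hZ.prodMk hX1).aemeasurable (measurableSet_eq_fun hF measurable_const)]
    filter_upwards [h] with ω hω
    rwa [robbinsMonro_succ γ Xs Z₁ hn] at hω
  -- By Fubini, some frozen value `z` of the iterate would be sent to `m` for almost every `X`.
  obtain ⟨z, hz⟩ := (Measure.ae_ae_of_ae_prod h1).exists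
  exact hA1.not_ae_add_unitDir_eq hX hγ z m (ae_of_ae_map hX.aemeasurable hz)

/-- One step of the recursion decreases the quadratic error by a factor close to `1` at most,
and always adds the variance `γ n ^ 2` of the unit direction. -/
lemma le_quadError_succ {γ : ℕ → ℝ} {C : ℝ≥0} (hX : Measurable X)
    (hC : ∀ h : H, ∫⁻ ω, ‖X ω - h‖ₑ⁻¹ ∂P ≤ C) (hm : IsGeometricMedian P X m)
    (hXs_meas : ∀ n, 1 ≤ n → Measurable (Xs n)) (hXs : IsIIDCopies P X Xs)
    (hZ₁_meas : Measurable Z₁) (hZ₁_bdd : ∃ R : ℝ, ∀ᵐ ω ∂P, ‖Z₁ ω‖ ≤ R)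
    (hZ₁_indep : IndepFun Z₁ (fun ω (n : ℕ) => Xs (n + 2) ω) P) {n : ℕ} (hn : 1 ≤ n)
    (hγ : 0 ≤ γ n) :
    (1 - 4 * C * γ n) * quadError P (robbinsMonro γ Xs Z₁) m n + γ n ^ 2
      ≤ quadError P (robbinsMonro γ Xs Z₁) m (n + 1) := by
  have hZ := measurable_robbinsMonro γ hXs_meas hZ₁_meas hn
  have hX1 := hXs_meas (n + 1) (by omega)
  have hmap := map_robbinsMonro_prodMk γ hXs_meas hXs hZ₁_meas hZ₁_indep hn
  have hsq := integrable_sq_norm_robbinsMonro_sub (P := P) γ m hXs_meas hZ₁_meas hZ₁_bdd hn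
  obtain ⟨R, hR⟩ := exists_ae_norm_robbinsMonro_le γ Xs hZ₁_bdd hn
  set Z := robbinsMonro γ Xs Z₁ n with hZdef
  have := Measure.isProbabilityMeasure_map (μ := P) hZ.aemeasurable
  have := Measure.isProbabilityMeasure_map (μ := P) hX.aemeasurable
  let F : H × H → ℝ := fun p => ⟪unitDir (p.2 - p.1), p.1 - m⟫
  have hF : Measurable F :=
    (measurable_unitDir.comp (measurable_snd.sub measurable_fst)).inner
      (measurable_fst.sub_const m)
  have hFint : Integrable (fun ω => F (Z ω, Xs (n + 1) ω)) P := by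
    refine Integrable.of_bound (C := R + ‖m‖) (hF.comp (hZ.prodMk hX1)).aestronglyMeasurable ?_
    filter_upwards [hR] with ω hω
    exact (abs_inner_unitDir_le _ _).trans ((norm_sub_le _ _).trans (by gcongr))
  have hFint' : Integrable F ((P.map Z).prod (P.map X)) := by
    rw [← hmap, integrable_map_measure hF.aestronglyMeasurable (hZ.prodMk hX1).aemeasurable]
    exact hFint
  -- The law of `X` has no atoms, so the direction has norm one and contributes the full `γ n ^ 2`.
  have hne : ∀ᵐ ω ∂P, Xs (n + 1) ω ≠ Z ω := by
    have hs : MeasurableSet {p : H × H | p.2 ≠ p.1} :=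
      (measurableSet_eq_fun measurable_snd measurable_fst).compl
    have h1 : ∀ᵐ p ∂(P.map Z).prod (P.map X), p.2 ≠ p.1 := by
      rw [Measure.ae_prod_iff_ae_ae hs]
      refine ae_of_all _ fun z => ?_
      exact (ae_map_iff hX.aemeasurable (measurableSet_singleton z).compl).2
        (ae_ne_of_lintegral_inv_le hX hC z)
    rw [← hmap] at h1
    exact ae_of_ae_map (hZ.prodMk hX1).aemeasurable h1
  have hdrift : -(2 * C) * quadError P (robbinsMonro γ Xs Z₁) m n
      ≤ ∫ ω, F (Z ω, Xs (n + 1) ω) ∂P := by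
    -- Independence allows averaging over `X` with `Z` frozen, where the pointwise drift bound
    -- applies.
    have e1 : ∫ ω, F (Z ω, Xs (n + 1) ω) ∂P = ∫ ω, ∫ ω', F (Z ω, X ω') ∂P ∂P := by
      rw [← integral_map (φ := fun ω => (Z ω, Xs (n + 1) ω)) (hZ.prodMk hX1).aemeasurable
        hF.aestronglyMeasurable, hmap, integral_prod _ hFint',
        integral_map hZ.aemeasurable hFint'.1.integral_prod_right']
      refine integral_congr_ae (ae_of_all _ fun ω => ?_)
      exact integral_map hX.aemeasurable
        (hF.comp (measurable_const.prodMk measurable_id)).aestronglyMeasurable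
    have e2 : Integrable (fun ω => ∫ ω', F (Z ω, X ω') ∂P) P := by
      have h1 := (integrable_map_measure hFint'.1.integral_prod_right' hZ.aemeasurable).1
        hFint'.integral_prod_left
      refine h1.congr (ae_of_all _ fun ω => ?_)
      exact integral_map hX.aemeasurable
        (hF.comp (measurable_const.prodMk measurable_id)).aestronglyMeasurable
    rw [e1, quadError, ← integral_const_mul]
    refine integral_mono (hsq.const_mul _) e2 fun ω => ?_
    have := hm.neg_le_integral_inner_unitDir hX hC (Z ω)
    simp only [F]
    linarith
  have hexp : quadError P (robbinsMonro γ Xs Z₁) m (n + 1)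
      = quadError P (robbinsMonro γ Xs Z₁) m n + 2 * γ n * ∫ ω, F (Z ω, Xs (n + 1) ω) ∂P
        + γ n ^ 2 := by
    have e : ∫ ω, (‖Z ω - m‖ ^ 2 + 2 * γ n * F (Z ω, Xs (n + 1) ω) + γ n ^ 2) ∂P
        = ∫ ω, ‖Z ω - m‖ ^ 2 ∂P + 2 * γ n * ∫ ω, F (Z ω, Xs (n + 1) ω) ∂P + γ n ^ 2 := by
      have h2 := hFint.const_mul (2 * γ n)
      rw [integral_add (f := fun ω => ‖Z ω - m‖ ^ 2 + 2 * γ n * F (Z ω, Xs (n + 1) ω))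
        (hsq.add h2) (integrable_const _), integral_add hsq h2, integral_const_mul]
      simp
    rw [quadError, quadError, ← hZdef, ← e]
    refine integral_congr_ae ?_
    filter_upwards [hne] with ω hω
    have h1 : robbinsMonro γ Xs Z₁ (n + 1) ω - m
        = (Z ω - m) + γ n • unitDir (Xs (n + 1) ω - Z ω) := by
      rw [robbinsMonro_succ γ Xs Z₁ hn]
      abel
    rw [h1, norm_add_sq_real, real_inner_smul_right, real_inner_comm, norm_smul,
      norm_unitDir (sub_ne_zero.2 hω), mul_one, Real.norm_eq_abs, sq_abs]
    simp only [F]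
    ring
  rw [hexp]
  nlinarith

end LowerBound

/-! ### Deterministic recursion and rates -/

section Sequences

lemma exists_const_mul_le_of_recursion {V γ : ℕ → ℝ} {K : ℝ} (hK : 0 < K)
    (hγ : ∀ n, 1 ≤ n → 0 < γ n) (hanti : ∀ n, 1 ≤ n → γ (n + 1) ≤ γ n)
    (hlim : Tendsto γ atTop (nhds 0)) {n₀ : ℕ} (hn₀ : 1 ≤ n₀) (hV : ∀ n, n₀ ≤ n → 0 < V n)
    (hrec : ∀ n, 1 ≤ n → (1 - K * γ n) * V n + γ n ^ 2 ≤ V (n + 1)) :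
    ∃ a : ℝ, 0 < a ∧ ∀ n, n₀ ≤ n → a * γ n ≤ V n := by
  obtain ⟨N, hN⟩ := eventually_atTop.1 (hlim.eventually_lt_const (inv_pos.2 hK))
  -- A minimum of finitely many ratios `V n / γ n`, capped at `K⁻¹` for the induction below.
  have hpos : ∀ M, ∃ a : ℝ, 0 < a ∧ a ≤ K⁻¹ ∧ ∀ n, n₀ ≤ n → n ≤ M → a * γ n ≤ V n := by
    intro M
    induction M with
    | zero => exact ⟨K⁻¹, inv_pos.2 hK, le_rfl, fun n h1 h2 => by omega⟩
    | succ M ih =>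
      obtain ⟨a, ha, haK, h⟩ := ih
      by_cases hM : n₀ ≤ M + 1
      · have hg := hγ (M + 1) (by omega)
        refine ⟨min a (V (M + 1) / γ (M + 1)), lt_min ha (div_pos (hV _ hM) hg),
          (min_le_left _ _).trans haK, fun n h1 h2 => ?_⟩
        rcases Nat.le_succ_iff.1 h2 with h3 | rfl
        · exact (mul_le_mul_of_nonneg_right (min_le_left _ _) (hγ n (by omega)).le).trans
            (h n h1 h3)
        · exact (le_div_iff₀ hg).1 (min_le_right _ _)
      · exact ⟨a, ha, haK, fun n h1 h2 => by omega⟩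
  obtain ⟨a, ha, haK, h⟩ := hpos (max N n₀)
  refine ⟨a, ha, fun n hn => ?_⟩
  rcases le_total n (max N n₀) with h1 | h1
  · exact h n hn h1
  · induction n, h1 using Nat.le_induction with
    | base => exact h _ hn le_rfl
    | succ n h1 ih =>
      have hn1 : n₀ ≤ n := (le_max_right _ _).trans h1
      have hg := hγ n (by omega)
      have h2 := ih hn1
      have h3 : K * γ n ≤ 1 := by
        have := mul_le_mul_of_nonneg_left (hN n ((le_max_left _ _).trans h1)).le hK.le
        rwa [mul_inv_cancel₀ hK.ne'] at this
      have h4 : K * a ≤ 1 := by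
        have := mul_le_mul_of_nonneg_left haK hK.le
        rwa [mul_inv_cancel₀ hK.ne'] at this
      -- The lower bound at `n` equals `a γ + (1 - K a) γ²`, hence `a ≤ K⁻¹`; replacing `V n` by `a
      -- γ` needs `K γ ≤ 1`.
      calc a * γ (n + 1) ≤ a * γ n := by gcongr; exact hanti n (by omega)
        _ ≤ (1 - K * γ n) * (a * γ n) + γ n ^ 2 := by
          nlinarith [mul_nonneg (sub_nonneg.2 h4) (sq_nonneg (γ n))]
        _ ≤ (1 - K * γ n) * V n + γ n ^ 2 := by
          gcongr
        _ ≤ V (n + 1) := hrec n (by omega)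

lemma stepSize_pos {c : ℝ} (hc : 0 < c) (α : ℝ) {n : ℕ} (hn : 1 ≤ n) :
    0 < stepSize c α n :=
  mul_pos hc (Real.rpow_pos_of_pos (by exact_mod_cast hn) _)

lemma stepSize_succ_le {c α : ℝ} (hc : 0 < c) (hα : 0 < α) {n : ℕ} (hn : 1 ≤ n) :
    stepSize c α (n + 1) ≤ stepSize c α n := by
  refine mul_le_mul_of_nonneg_left ?_ hc.le
  exact Real.rpow_le_rpow_of_nonpos (by exact_mod_cast hn) (by push_cast; linarith)
    (by linarith)

lemma tendsto_stepSize {α : ℝ} (c : ℝ) (hα : 0 < α) :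
    Tendsto (stepSize c α) atTop (nhds 0) := by
  have h := ((tendsto_rpow_neg_atTop hα).comp tendsto_natCast_atTop_atTop).const_mul c
  rw [mul_zero] at h
  exact h

lemma not_isBigO_one_div_of_le {V : ℕ → ℝ} {a α : ℝ} (ha : 0 < a) (hα : α < 1) {n₀ : ℕ}
    (hV : ∀ n : ℕ, n₀ ≤ n → a / (n : ℝ) ^ α ≤ V n) :
    ¬ V =O[atTop] fun n : ℕ => 1 / (n : ℝ) := fun h => by
  obtain ⟨B, hB⟩ := h.bound
  have hlim : Tendsto (fun n : ℕ => (n : ℝ) ^ (1 - α)) atTop atTop :=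
    (tendsto_rpow_atTop (sub_pos.2 hα)).comp tendsto_natCast_atTop_atTop
  obtain ⟨n, ⟨⟨h1, h2⟩, h3⟩, h4⟩ := (((hB.and (hlim.eventually_gt_atTop (B / a))).and
    (eventually_ge_atTop n₀)).and (eventually_ge_atTop 1)).exists
  have hn : (0 : ℝ) < n := by exact_mod_cast h4
  have hp : (n : ℝ) ^ (1 - α) = n / (n : ℝ) ^ α := by rw [Real.rpow_sub hn, Real.rpow_one]
  have h5 : V n ≤ B * (1 / n) := by
    rw [Real.norm_of_nonneg (by positivity : (0 : ℝ) ≤ 1 / (n : ℝ))] at h1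
    exact (le_abs_self _).trans h1
  have h6 := mul_le_mul_of_nonneg_right ((hV n h3).trans h5) hn.le
  rw [hp, div_lt_iff₀ ha] at h2
  have h7 : B * (1 / n) * n = B := by field_simp
  have h8 : a / (n : ℝ) ^ α * n = n / (n : ℝ) ^ α * a := by ring
  linarith

end Sequences

end OnlineMedian

/-! ### The lower bounds and the failure of the parametric rate -/

theorem proposition3p1
    {Ω : Type*} [MeasurableSpace Ω] (P : Measure Ω) [IsProbabilityMeasure P]
    {H : Type*} [NormedAddCommGroup H] [InnerProductSpace ℝ H] [CompleteSpace H]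
    [TopologicalSpace.SeparableSpace H] [MeasurableSpace H] [BorelSpace H]
    -- the random variable, its geometric median, and the three assumptions
    (X : Ω → H) (hX : Measurable X)
    (m : H) (hm : OnlineMedian.IsGeometricMedian P X m)
    (hA1 : OnlineMedian.NotOnLine P X)
    (hA2 : OnlineMedian.BoundedInvMoment P X)
    (hA3 : OnlineMedian.BoundedInvSqMoment P X)
    -- the sample
    (Xs : ℕ → Ω → H) (hXs_meas : ∀ n, 1 ≤ n → Measurable (Xs n))
    (hXs : OnlineMedian.IsIIDCopies P X Xs)
    -- the bounded starting point, independent of the later observations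
    (Z₁ : Ω → H) (hZ₁_meas : Measurable Z₁)
    (hZ₁_bdd : ∃ R : ℝ, ∀ᵐ ω ∂P, ‖Z₁ ω‖ ≤ R)
    (hZ₁_indep : IndepFun Z₁ (fun ω (n : ℕ) => Xs (n + 2) ω) P)
    -- the step sizes
    (c : ℝ) (hc : 0 < c) (α : ℝ) (hα : α ∈ Set.Ioo (1 / 2 : ℝ) 1) :
    -- the lower bound for all `n ≥ 1`, provided that `Z₁` is not a.s. equal to `m`
    ((¬ ∀ᵐ ω ∂P, Z₁ ω = m) → ∃ C' : ℝ, 0 < C' ∧ ∀ n : ℕ, 1 ≤ n →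
      C' / (n : ℝ) ^ α ≤ OnlineMedian.quadError P
        (OnlineMedian.robbinsMonro (OnlineMedian.stepSize c α) Xs Z₁) m n) ∧
    -- the lower bound for all `n ≥ 2`, without any proviso
    (∃ C' : ℝ, 0 < C' ∧ ∀ n : ℕ, 2 ≤ n →
      C' / (n : ℝ) ^ α ≤ OnlineMedian.quadError P
        (OnlineMedian.robbinsMonro (OnlineMedian.stepSize c α) Xs Z₁) m n) ∧
    -- the parametric rate is not reached
    ¬ (OnlineMedian.quadError P
        (OnlineMedian.robbinsMonro (OnlineMedian.stepSize c α) Xs Z₁) m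
      =O[atTop] fun n : ℕ => 1 / (n : ℝ)) := by
  have : SecondCountableTopology H := UniformSpace.secondCountable_of_separable H
  obtain ⟨C, hC0, hC⟩ := hA2
  obtain ⟨hα1, hα2⟩ := hα
  have hα0 : 0 < α := by linarith
  have lower : ∀ n₀ : ℕ, 1 ≤ n₀ →
      (∀ n, n₀ ≤ n → 0 < OnlineMedian.quadError P
        (OnlineMedian.robbinsMonro (OnlineMedian.stepSize c α) Xs Z₁) m n) →
      ∃ C' : ℝ, 0 < C' ∧ ∀ n : ℕ, n₀ ≤ n → C' / (n : ℝ) ^ α ≤ OnlineMedian.quadError P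
        (OnlineMedian.robbinsMonro (OnlineMedian.stepSize c α) Xs Z₁) m n := by
    intro n₀ hn₀ hpos
    obtain ⟨a, ha, h⟩ := OnlineMedian.exists_const_mul_le_of_recursion
      (K := 4 * C) (by positivity) (fun n hn => OnlineMedian.stepSize_pos hc α hn)
      (fun n hn => OnlineMedian.stepSize_succ_le hc hα0 hn)
      (OnlineMedian.tendsto_stepSize c hα0) hn₀ hpos
      (fun n hn => OnlineMedian.le_quadError_succ hX hC hm hXs_meas hXs hZ₁_meas hZ₁_bdd
        hZ₁_indep hn (OnlineMedian.stepSize_pos hc α hn).le)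
    refine ⟨a * c, mul_pos ha hc, fun n hn => le_trans (le_of_eq ?_) (h n hn)⟩
    rw [OnlineMedian.stepSize, Real.rpow_neg n.cast_nonneg, div_eq_mul_inv, mul_assoc]
  have hpos : ∀ n, 2 ≤ n → 0 < OnlineMedian.quadError P
      (OnlineMedian.robbinsMonro (OnlineMedian.stepSize c α) Xs Z₁) m n := fun n hn => by
    obtain ⟨k, rfl⟩ := Nat.exists_eq_add_of_le' hn
    exact OnlineMedian.quadError_succ_pos (n := k + 1) hX hA1 hXs_meas hXs hZ₁_meas hZ₁_bdd
      hZ₁_indep (by omega) (OnlineMedian.stepSize_pos hc α (by omega)).ne' m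
  have htwo := lower 2 (by omega) hpos
  refine ⟨fun hne => lower 1 le_rfl fun n hn => ?_, htwo, ?_⟩
  · rcases hn.eq_or_lt with rfl | hn
    · exact OnlineMedian.quadError_pos_of_not_ae_eq _ hXs_meas hZ₁_meas hZ₁_bdd le_rfl hne
    · exact hpos n hn
  · obtain ⟨C', hC', h⟩ := htwo
    exact OnlineMedian.not_isBigO_one_div_of_le hC' hα2 h
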